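/- For $n$ odd and $x\in\{-1,1\}^n$, with coordinates indexed cyclically (so that coordinates $1$ and $n$ are adjacent), let $M_n(x)\in\{-1,1\}^n$ be given by \[M_n(x)(i)=\mathrm{sign}\bigl(x(i-1)+x(i)+x(i+1)\bigr),\qquad i\in\mathbb{Z}/n\mathbb{Z}.\] For $T\ge 0$ let $f_{n,T}:\{-1,1\}^n\to\{-1,1\}$ be the convolutional iterated $3$-majority function with stride $1$ and $T$ layers on the $n$-cycle, that is, \[f_{n,T}(\omega)=\mathrm{sign}\Bigl(\sum_{i=1}^n M_n^{T}(\omega)(i)\Bigr),\] where $M_n^T$ is the $T$-fold iterate of $M_n$. Let $\omega$ be uniformly distributed on $\{-1,1\}^n$ and, for $0\le\epsilon\le1$, let $\omega^\epsilon$ be obtained from $\omega$ by flipping the sign of each coordinate independently with probability $\epsilon$. Theorem. For every sequence $(T_n)_n$ of non-negative integers, the sequence $(f_{n,T_n})_{n\ \mathrm{odd}}$ is noise stable, i.e. \[\lim_{\epsilon\downarrow 0}\ \sup_{n\ \mathrm{odd}}\ \mathrm{P}\bigl(f_{n,T_n}(\omega)\ne f_{n,T_n}(\omega^\epsilon)\bigr)=0.\]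 -/

import Mathlib

open Filter Topology MeasureTheory

noncomputable section

/- The two-point set `{-1, 1}` is the type `ℤˣ` of units of `ℤ`. -/

/-- All subsets of `ℤˣ` are measurable. -/
instance : DiscreteMeasurableSpace ℤˣ :=
  ⟨fun s => ⟨Units.val '' s, MeasurableSet.of_discrete, Set.preimage_image_eq s Units.val_injective⟩⟩

/-- The majority of a finite family of signs, i.e. the sign of their sum. It is only used for
families of odd size, where the sum is never zero. -/
def majority {ι : Type*} [Fintype ι] (x : ι → ℤˣ) : ℤˣ :=
  if 0 < ∑ i, ((x i : ℤˣ) : ℤ) then 1 else -1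

/-- One layer of 3-majority with stride 1 on the `n`-cycle: the output at node `i` is the majority
of the inputs at the nodes `i - 1`, `i`, `i + 1`, indices being cyclic
(`finRotate n` is the cyclic shift `i ↦ i + 1` of `Fin n`). -/
def cycleLayer (n : ℕ) (x : Fin n → ℤˣ) : Fin n → ℤˣ :=
  fun i => majority ![x ((finRotate n).symm i), x i, x (finRotate n i)]

/-- The convolutional iterated 3-majority function with stride 1 on the `n`-cycle, with `T` layers:
the majority of all `n` values in layer `T`. -/
def cycleIteratedMajority (n T : ℕ) (ω : Fin n → ℤˣ) : ℤˣ :=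
  majority ((cycleLayer n)^[T] ω)

/-- The law of a random sign that equals `-1` with probability `p` and `1` with probability
`1 - p`, for `0 ≤ p ≤ 1`. -/
def signLaw (p : ℝ) : Measure ℤˣ :=
  ENNReal.ofReal (1 - p) • Measure.dirac 1 + ENNReal.ofReal p • Measure.dirac (-1)

/-- The joint law of a uniform random input `ω` (independent fair signs) and an independent noise
vector `η` whose coordinates are independent and equal to `-1` with probability `ε`. -/
def noiseLaw (N : ℕ) (ε : ℝ) : Measure ((Fin N → ℤˣ) × (Fin N → ℤˣ)) :=
  (Measure.pi fun _ => signLaw (1 / 2)).prod (Measure.pi fun _ => signLaw ε)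

/-- The probability that `f ω ≠ f ω^ε`, where `ω^ε = ω * η` is obtained from the uniform `ω` by
flipping each coordinate independently with probability `ε`. -/
def disagreementProb {N : ℕ} (f : (Fin N → ℤˣ) → ℤˣ) (ε : ℝ) : ENNReal :=
  noiseLaw N ε {p | f p.1 ≠ f (p.1 * p.2)}

/-- A family of Boolean functions is noise stable if `sup_n P(f_n(ω) ≠ f_n(ω^ε)) → 0` as `ε ↓ 0`. -/
def NoiseStable {ι : Type*} {N : ι → ℕ} (f : (n : ι) → (Fin (N n) → ℤˣ) → ℤˣ) : Prop :=
  Tendsto (fun ε : ℝ => ⨆ n, disagreementProb (f n) ε) (𝓝[>] 0) (𝓝 0)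

end

/-!
Two equal neighbouring signs never change again and shield the sites behind them, so flipping one
input affects the later layers only along the alternating runs that start next to it. Under the
uniform law such a run has length `≥ d` with probability `O(2⁻ᵈ)`, hence a flip changes the sum `S`
of layer `T` by `O(1)` in mean square, uniformly in `T` and `n`. Averaging out one coordinate after
the other, noise of rate `ε` therefore changes `S` by `O(√(εn))` in mean square.

On the other hand `S` spreads over a window of width of order `√n`. Cut the cycle into blocks of six
sites and call a block good if it consists of three pairs of equal signs. Flipping the middle pair
of a good block changes `S` by exactly `4` and is invisible to the other blocks. About `n / 48` of
the blocks are good, and summing by parts over these moves gives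
`P(|S| ≤ K) = O((K + 1) / √n)`. The sign of `S` can change only if `|S| ≤ K` or if the noise moves
`S` by at least `K`; take `K = ε^(1/3) √n`.
-/

open Function
open scoped BigOperators

section Flip

variable {ι : Type*} [DecidableEq ι]

/-- The configuration obtained from `ω` by flipping the sign at the site `k`. -/
def flipAt (k : ι) (ω : ι → ℤˣ) : ι → ℤˣ :=
  update ω k (-ω k)

lemma flipAt_self (k : ι) (ω : ι → ℤˣ) : flipAt k ω k = -ω k :=
  update_self k _ ω

lemma flipAt_of_ne {i k : ι} (h : i ≠ k) (ω : ι → ℤˣ) : flipAt k ω i = ω i :=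
  update_of_ne h _ ω

lemma flipAt_involutive (k : ι) : Involutive (flipAt k) := fun ω => by
  simp [flipAt]

end Flip

section UniformSigns

lemma expect_ite_and_eq_half {α : Type*} [Fintype α] {τ : α → α} (hτ : Bijective τ)
    {p q : α → Prop} [DecidablePred p] [DecidablePred q] (hp : ∀ ω, p (τ ω) ↔ ¬p ω)
    (hq : ∀ ω, q (τ ω) ↔ q ω) :
    𝔼 ω, (if p ω ∧ q ω then (1 : ℝ) else 0) = (𝔼 ω, if q ω then (1 : ℝ) else 0) / 2 := by
  have hnot : 𝔼 ω, (if p ω ∧ q ω then (1 : ℝ) else 0) = 𝔼 ω, if ¬p ω ∧ q ω then (1 : ℝ) else 0 :=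
    (Fintype.expect_bijective τ hτ _ _ fun ω => by simp only [hp, hq]).symm
  have hadd : 𝔼 ω, (if p ω ∧ q ω then (1 : ℝ) else 0)
      + 𝔼 ω, (if ¬p ω ∧ q ω then (1 : ℝ) else 0) = 𝔼 ω, if q ω then (1 : ℝ) else 0 := by
    rw [← Finset.expect_add_distrib]
    refine Finset.expect_congr rfl fun ω _ => ?_
    by_cases h : p ω <;> simp [h]
  linarith

/-- Revealing the constraints in increasing order, the site `b i` is fresh when the `i`-th one is
revealed, so each of them holds with conditional probability `1 / 2`. -/
lemma expect_ite_forall_eq_mul {ι κ : Type*} [Fintype ι] [DecidableEq ι] [LinearOrder κ]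
    (s : Finset κ) {a b : κ → ι} (σ : ℤˣ) (hb : Set.InjOn b s)
    (hab : ∀ i ∈ s, ∀ j ∈ s, i ≤ j → a i ≠ b j) :
    𝔼 ω : ι → ℤˣ, (if ∀ i ∈ s, ω (b i) = σ * ω (a i) then (1 : ℝ) else 0) = (1 / 2) ^ s.card := by
  induction s using Finset.induction_on_max with
  | empty => simp
  | insert j s hj ih =>
    have hjs : j ∉ s := fun h => (hj j h).false
    have hbj : ∀ i ∈ s, b i ≠ b j := fun i hi h =>
      (hj i hi).ne (hb (by simp [hi]) (by simp) h)
    have haj : ∀ i ∈ s, a i ≠ b j := fun i hi =>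
      hab i (by simp [hi]) j (by simp) (hj i hi).le
    have hjj : a j ≠ b j := hab j (by simp) j (by simp) le_rfl
    simp only [Finset.forall_mem_insert]
    rw [expect_ite_and_eq_half (flipAt_involutive (b j)).bijective, ih (hb.mono (by simp))
      fun i hi l hl => hab i (by simp [hi]) l (by simp [hl]), Finset.card_insert_of_notMem hjs]
    · ring
    · intro ω
      rw [flipAt_self, flipAt_of_ne hjj, ← Int.units_ne_iff_eq_neg.trans neg_eq_iff_eq_neg.symm]
    · intro ω
      refine forall₂_congr fun i hi => ?_
      rw [flipAt_of_ne (hbj i hi), flipAt_of_ne (haj i hi)]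

lemma expect_cons {n : ℕ} (F : (Fin (n + 1) → ℤˣ) → ℝ) :
    𝔼 ω, F ω = 𝔼 ω : Fin n → ℤˣ, (F (Fin.cons 1 ω) + F (Fin.cons (-1) ω)) / 2 := by
  rw [← Fintype.expect_equiv (Fin.consEquiv fun _ => ℤˣ) (fun p => F (Fin.cons p.1 p.2)) F
    fun _ => rfl, ← Finset.univ_product_univ, Finset.expect_product, Finset.expect_comm]
  refine Finset.expect_congr rfl fun ω _ => ?_
  rw [Finset.expect_eq_sum_div_card, UnitsInt.univ, Finset.sum_pair (by decide)]
  simp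

end UniformSigns

section Noise

/-- The probability of the noise vector `η` when its coordinates are independent and equal to `-1`
with probability `ε`. -/
def noiseWeight {ι : Type*} [Fintype ι] (ε : ℝ) (η : ι → ℤˣ) : ℝ :=
  ∏ i, if η i = 1 then 1 - ε else ε

lemma noiseWeight_nonneg {ι : Type*} [Fintype ι] {ε : ℝ} (hε₀ : 0 ≤ ε) (hε₁ : ε ≤ 1) (η : ι → ℤˣ) :
    0 ≤ noiseWeight ε η :=
  Finset.prod_nonneg fun i _ => by split_ifs <;> linarith

lemma sum_noiseWeight {ι : Type*} [Fintype ι] [DecidableEq ι] (ε : ℝ) :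
    ∑ η : ι → ℤˣ, noiseWeight ε η = 1 := by
  simp only [noiseWeight]
  rw [← Fintype.piFinset_univ,
    ← Finset.prod_univ_sum (fun _ => Finset.univ) fun _ s => if s = (1 : ℤˣ) then 1 - ε else ε]
  simp [UnitsInt.univ]

lemma noiseWeight_half {ι : Type*} [Fintype ι] [DecidableEq ι] (η : ι → ℤˣ) :
    noiseWeight (1 / 2) η = (Fintype.card (ι → ℤˣ) : ℝ)⁻¹ := by
  simp only [noiseWeight, show (1 : ℝ) - 1 / 2 = 1 / 2 by norm_num, ite_self]
  simp

lemma expect_sum_noiseWeight_mul {ι : Type*} [Fintype ι] [DecidableEq ι] (ε : ℝ)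
    (F : (ι → ℤˣ) → ℝ) : 𝔼 ω, ∑ η : ι → ℤˣ, noiseWeight ε η * F ω = 𝔼 ω, F ω := by
  simp only [← Finset.sum_mul, sum_noiseWeight, one_mul]

lemma expect_sum_noiseWeight_mul_comp_mul {ι : Type*} [Fintype ι] [DecidableEq ι] (ε : ℝ)
    (F : (ι → ℤˣ) → ℝ) : 𝔼 ω, ∑ η, noiseWeight ε η * F (ω * η) = 𝔼 ω, F ω := by
  have hshift : ∀ η : ι → ℤˣ, 𝔼 ω, F (ω * η) = 𝔼 ω, F ω := fun η =>
    Fintype.expect_equiv (Equiv.mulRight η) _ F fun _ => rfl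
  simp only [Finset.expect_sum_comm, ← Finset.mul_expect, hshift, ← Finset.sum_mul,
    sum_noiseWeight, one_mul]

variable {n : ℕ}

/-- The mean square of the change of `g` when its uniform random argument is exposed to noise of
rate `ε`. -/
noncomputable def noiseEnergy (ε : ℝ) (g : (Fin n → ℤˣ) → ℝ) : ℝ :=
  𝔼 ω, ∑ η, noiseWeight ε η * (g ω - g (ω * η)) ^ 2

/-- The sum over all coordinates of the mean squared effect on `g` of flipping that coordinate. For
a function with values in `{-1, 1}` this is four times the total influence. -/
noncomputable def flipEnergy (g : (Fin n → ℤˣ) → ℝ) : ℝ :=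
  ∑ k, 𝔼 ω, (g ω - g (flipAt k ω)) ^ 2

/-- The average of `g` over its first coordinate. -/
noncomputable def headMean (g : (Fin (n + 1) → ℤˣ) → ℝ) (ω : Fin n → ℤˣ) : ℝ :=
  (g (Fin.cons 1 ω) + g (Fin.cons (-1) ω)) / 2

/-- The discrete derivative of `g` in its first coordinate, so that
`g (s, ω) = headMean g ω + s * headDeriv g ω`. -/
noncomputable def headDeriv (g : (Fin (n + 1) → ℤˣ) → ℝ) (ω : Fin n → ℤˣ) : ℝ :=
  (g (Fin.cons 1 ω) - g (Fin.cons (-1) ω)) / 2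

lemma apply_cons_one (g : (Fin (n + 1) → ℤˣ) → ℝ) (ω : Fin n → ℤˣ) :
    g (Fin.cons 1 ω) = headMean g ω + headDeriv g ω := by
  rw [headMean, headDeriv]; ring

lemma apply_cons_neg_one (g : (Fin (n + 1) → ℤˣ) → ℝ) (ω : Fin n → ℤˣ) :
    g (Fin.cons (-1) ω) = headMean g ω - headDeriv g ω := by
  rw [headMean, headDeriv]; ring

lemma flipAt_zero_cons (s : ℤˣ) (ω : Fin n → ℤˣ) :
    flipAt 0 (Fin.cons s ω : Fin (n + 1) → ℤˣ) = Fin.cons (-s) ω := by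
  simp [flipAt]

lemma flipAt_succ_cons (k : Fin n) (s : ℤˣ) (ω : Fin n → ℤˣ) :
    flipAt k.succ (Fin.cons s ω : Fin (n + 1) → ℤˣ) = Fin.cons s (flipAt k ω) := by
  simp [flipAt, Fin.cons_update]

lemma cons_mul_cons (s t : ℤˣ) (ω η : Fin n → ℤˣ) :
    (Fin.cons s ω * Fin.cons t η : Fin (n + 1) → ℤˣ) = Fin.cons (s * t) (ω * η) := by
  ext i
  cases i using Fin.cases <;> simp

lemma sum_noiseWeight_mul_cons (ε : ℝ) (F : (Fin (n + 1) → ℤˣ) → ℝ) :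
    ∑ η, noiseWeight ε η * F η = ∑ η : Fin n → ℤˣ,
      noiseWeight ε η * ((1 - ε) * F (Fin.cons 1 η) + ε * F (Fin.cons (-1) η)) := by
  rw [← Equiv.sum_comp (Fin.consEquiv fun _ => ℤˣ), Fintype.sum_prod_type, Finset.sum_comm]
  refine Finset.sum_congr rfl fun η _ => ?_
  simp only [UnitsInt.univ, noiseWeight, Fin.consEquiv, Equiv.coe_fn_mk, Fin.prod_univ_succ,
    Fin.cons_zero, Fin.cons_succ]
  rw [Finset.sum_pair (by decide), if_pos rfl, if_neg (by decide)]
  ring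

lemma flipEnergy_succ (g : (Fin (n + 1) → ℤˣ) → ℝ) :
    flipEnergy g
      = 4 * 𝔼 ω, headDeriv g ω ^ 2 + (flipEnergy (headMean g) + flipEnergy (headDeriv g)) := by
  simp only [flipEnergy, Fin.sum_univ_succ, expect_cons, ← Finset.sum_add_distrib,
    ← Finset.expect_add_distrib, Finset.mul_expect, flipAt_zero_cons, flipAt_succ_cons, neg_neg,
    apply_cons_one, apply_cons_neg_one]
  congr 1
  · exact Finset.expect_congr rfl fun ω _ => by ring
  · exact Finset.sum_congr rfl fun k _ => Finset.expect_congr rfl fun ω _ => by ring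

lemma noiseEnergy_succ_le {ε : ℝ} (hε₀ : 0 ≤ ε) (hε₁ : ε ≤ 1) (g : (Fin (n + 1) → ℤˣ) → ℝ) :
    noiseEnergy ε g
      ≤ 4 * ε * 𝔼 ω, headDeriv g ω ^ 2
        + (noiseEnergy ε (headMean g) + noiseEnergy ε (headDeriv g)) := by
  set a := headMean g
  set b := headDeriv g
  calc noiseEnergy ε g
      ≤ 𝔼 ω, ∑ η, (2 * ε * (noiseWeight ε η * b ω ^ 2)
          + 2 * ε * (noiseWeight ε η * b (ω * η) ^ 2)
          + (noiseWeight ε η * (a ω - a (ω * η)) ^ 2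
            + noiseWeight ε η * (b ω - b (ω * η)) ^ 2)) := by
        rw [noiseEnergy, expect_cons]
        refine Finset.expect_le_expect fun ω _ => ?_
        simp only [sum_noiseWeight_mul_cons ε fun η => (g _ - g (_ * η)) ^ 2]
        rw [← Finset.sum_add_distrib, Finset.sum_div]
        refine Finset.sum_le_sum fun η _ => ?_
        simp only [cons_mul_cons, mul_one, one_mul, neg_mul_neg, apply_cons_one,
          apply_cons_neg_one]
        have : 0 ≤ noiseWeight ε η * ε * (b ω - b (ω * η)) ^ 2 := by
          have := noiseWeight_nonneg hε₀ hε₁ η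
          positivity
        linarith
    _ = 4 * ε * 𝔼 ω, b ω ^ 2 + (noiseEnergy ε a + noiseEnergy ε b) := by
        simp only [Finset.sum_add_distrib, Finset.expect_add_distrib, ← Finset.mul_sum,
          ← Finset.mul_expect, expect_sum_noiseWeight_mul_comp_mul ε fun ω => b ω ^ 2, noiseEnergy]
        simp only [expect_sum_noiseWeight_mul ε fun ω => b ω ^ 2]
        ring

theorem noiseEnergy_le_mul_flipEnergy {ε : ℝ} (hε₀ : 0 ≤ ε) (hε₁ : ε ≤ 1)
    (g : (Fin n → ℤˣ) → ℝ) : noiseEnergy ε g ≤ ε * flipEnergy g := by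
  induction n with
  | zero =>
    have hconst : ∀ ω η : Fin 0 → ℤˣ, ω * η = ω := fun _ _ => Subsingleton.elim _ _
    simp [noiseEnergy, flipEnergy, hconst]
  | succ n ih =>
    rw [flipEnergy_succ]
    linarith [noiseEnergy_succ_le hε₀ hε₁ g, ih (headMean g), ih (headDeriv g)]

end Noise

section Dynamics

variable {ι : Type*}

lemma majority_three (a b c : ℤˣ) : majority ![a, b, c] = if a = b then a else c := by
  revert a b c; decide

/-- One layer of 3-majority in which the neighbours of a site `i` are `r.symm i` and `r i`. The
`n`-cycle is the case `r = finRotate n`. -/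
def permLayer (r : Equiv.Perm ι) (x : ι → ℤˣ) : ι → ℤˣ :=
  fun i => majority ![x (r.symm i), x i, x (r i)]

lemma permLayer_apply (r : Equiv.Perm ι) (x : ι → ℤˣ) (i : ι) :
    permLayer r x i = if x (r.symm i) = x i then x (r.symm i) else x (r i) :=
  majority_three _ _ _

lemma permLayer_symm (r : Equiv.Perm ι) : permLayer r.symm = permLayer r := by
  funext x i
  rw [permLayer_apply, permLayer_apply, Equiv.symm_symm]
  generalize x i = b, x (r i) = c, x (r.symm i) = a
  revert a b c; decide

/-- The site `i` agrees with one of its neighbours; it then keeps its sign in all later layers. -/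
def IsFrozen (r : Equiv.Perm ι) (x : ι → ℤˣ) (i : ι) : Prop :=
  x i = x (r i) ∨ x i = x (r.symm i)

lemma iterate_permLayer_of_eq {r : Equiv.Perm ι} {x : ι → ℤˣ} {i : ι} (h : x i = x (r i)) (t : ℕ) :
    (permLayer r)^[t] x i = x i ∧ (permLayer r)^[t] x (r i) = x i := by
  induction t with
  | zero => exact ⟨rfl, h.symm⟩
  | succ t ih =>
    rw [iterate_succ_apply']
    refine ⟨?_, ?_⟩
    · rw [permLayer_apply, ih.1, ih.2, ite_eq_right_iff]
      exact id
    · rw [permLayer_apply, Equiv.symm_apply_apply, ih.1, ih.2, if_pos rfl]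

lemma IsFrozen.iterate_eq {r : Equiv.Perm ι} {x : ι → ℤˣ} {i : ι} (h : IsFrozen r x i) (t : ℕ) :
    (permLayer r)^[t] x i = x i := by
  rcases h with h | h
  · exact (iterate_permLayer_of_eq h t).1
  · rw [← permLayer_symm]
    exact (iterate_permLayer_of_eq h t).1

/-- No information crosses a frozen site, so agreement persists on a set with frozen boundary. -/
lemma eqOn_iterate_permLayer {r : Equiv.Perm ι} {x y : ι → ℤˣ} {s : Set ι} (hxy : Set.EqOn x y s)
    (hs : ∀ i ∈ s, IsFrozen r x i ∧ IsFrozen r y i ∨ r i ∈ s ∧ r.symm i ∈ s) (t : ℕ) :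
    Set.EqOn ((permLayer r)^[t] x) ((permLayer r)^[t] y) s := by
  induction t with
  | zero => exact hxy
  | succ t ih =>
    intro i hi
    rcases hs i hi with ⟨hx, hy⟩ | ⟨hnext, hprev⟩
    · rw [hx.iterate_eq, hy.iterate_eq, hxy hi]
    · simp only [iterate_succ_apply', permLayer_apply, ih hi, ih hnext, ih hprev]

open Classical in
/-- The numbers of steps `d` from `k` along `r`, up to one period, such that `ω` alternates strictly
between the sites `r k` and `r^[d] k`. The pair `k, r k` is left unconstrained because the sign at
`k` is going to be flipped. -/
noncomputable def runSteps (r : Equiv.Perm ι) (k : ι) (ω : ι → ℤˣ) : Finset ℕ :=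
  {d ∈ Finset.range (minimalPeriod r k) | ∀ e ∈ Finset.Ioo 0 d, ω (r^[e] k) ≠ ω (r^[e + 1] k)}

lemma mem_runSteps {r : Equiv.Perm ι} {k : ι} {ω : ι → ℤˣ} {d : ℕ} :
    d ∈ runSteps r k ω ↔
      d < minimalPeriod r k ∧ ∀ e ∈ Finset.Ioo 0 d, ω (r^[e] k) ≠ ω (r^[e + 1] k) := by
  simp only [runSteps, Finset.mem_filter, Finset.mem_range]

lemma mem_runSteps_of_le {r : Equiv.Perm ι} {k : ι} {ω : ι → ℤˣ} {d e : ℕ}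
    (hd : d ∈ runSteps r k ω) (hed : e ≤ d) : e ∈ runSteps r k ω := by
  rw [mem_runSteps] at hd ⊢
  exact ⟨hed.trans_lt hd.1, fun i hi => hd.2 i (Finset.Ioo_subset_Ioo_right hed hi)⟩

lemma minimalPeriod_perm_pos [Finite ι] (r : Equiv.Perm ι) (k : ι) : 0 < minimalPeriod r k :=
  minimalPeriod_pos_of_mem_periodicPts (r.injective.mem_periodicPts k)

lemma zero_mem_runSteps [Finite ι] (r : Equiv.Perm ι) (k : ι) (ω : ι → ℤˣ) :
    0 ∈ runSteps r k ω := by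
  simp [mem_runSteps, minimalPeriod_perm_pos]

variable [DecidableEq ι]

/-- The sites reached from `k` by the alternating runs in both directions. Flipping the sign at `k`
changes later layers on these sites only. -/
noncomputable def influenceZone (r : Equiv.Perm ι) (k : ι) (ω : ι → ℤˣ) : Finset ι :=
  (runSteps r k ω).image (r^[·] k) ∪ (runSteps r.symm k ω).image (r.symm^[·] k)

lemma influenceZone_symm (r : Equiv.Perm ι) (k : ι) (ω : ι → ℤˣ) :
    influenceZone r.symm k ω = influenceZone r k ω := by
  rw [influenceZone, Equiv.symm_symm, Finset.union_comm, influenceZone]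

lemma card_influenceZone_le (r : Equiv.Perm ι) (k : ι) (ω : ι → ℤˣ) :
    (influenceZone r k ω).card ≤ (runSteps r k ω).card + (runSteps r.symm k ω).card :=
  (Finset.card_union_le _ _).trans (add_le_add Finset.card_image_le Finset.card_image_le)

variable [Finite ι]

lemma self_mem_influenceZone (r : Equiv.Perm ι) (k : ι) (ω : ι → ℤˣ) :
    k ∈ influenceZone r k ω :=
  Finset.mem_union_left _ (Finset.mem_image.2 ⟨0, zero_mem_runSteps r k ω, rfl⟩)

lemma eq_of_mem_of_notMem_influenceZone {r : Equiv.Perm ι} {k i : ι} {ω : ι → ℤˣ}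
    (hi : i ∈ influenceZone r k ω) (hri : r i ∉ influenceZone r k ω) : i ≠ k ∧ ω i = ω (r i) := by
  simp only [influenceZone, Finset.mem_union, Finset.mem_image, not_or, not_exists, not_and]
    at hi hri
  obtain ⟨d, hd, rfl⟩ : ∃ d ∈ runSteps r k ω, r^[d] k = i := by
    rcases hi with hi | ⟨_ | d, hd, rfl⟩
    · exact hi
    · exact ⟨0, zero_mem_runSteps r k ω, rfl⟩
    · refine absurd ?_ (hri.2 d (mem_runSteps_of_le hd d.le_succ))
      rw [iterate_succ_apply', Equiv.apply_symm_apply]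
  have hd_succ : d + 1 ∉ runSteps r k ω := fun h => hri.1 _ h (iterate_succ_apply' _ _ _)
  have hperiod : d + 1 < minimalPeriod r k := by
    refine lt_of_le_of_ne (mem_runSteps.1 hd).1 fun h => hri.1 0 (zero_mem_runSteps r k ω) ?_
    rw [← iterate_succ_apply' (⇑r), Nat.succ_eq_add_one, h, iterate_minimalPeriod,
      iterate_zero_apply]
  have hpos : 0 < d := by
    refine Nat.pos_of_ne_zero fun h => hd_succ (mem_runSteps.2 ⟨hperiod, fun e he => ?_⟩)
    rw [Finset.mem_Ioo] at he
    lia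
  refine ⟨fun h => ?_, ?_⟩
  · exact (Nat.le_of_dvd hpos (IsPeriodicPt.minimalPeriod_dvd h)).not_gt (by lia)
  · by_contra hne
    refine hd_succ (mem_runSteps.2 ⟨hperiod, fun e he => ?_⟩)
    rcases (Nat.lt_succ_iff.1 (Finset.mem_Ioo.1 he).2).eq_or_lt with rfl | hed
    · rwa [iterate_succ_apply']
    · exact (mem_runSteps.1 hd).2 e (Finset.mem_Ioo.2 ⟨(Finset.mem_Ioo.1 he).1, hed⟩)

lemma isFrozen_of_apply_mem_influenceZone {r : Equiv.Perm ι} {k i : ι} {ω : ι → ℤˣ}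
    (hi : i ∉ influenceZone r k ω) (hri : r i ∈ influenceZone r k ω) :
    IsFrozen r ω i ∧ IsFrozen r (flipAt k ω) i := by
  rw [← influenceZone_symm] at hi hri
  obtain ⟨hne, heq⟩ := eq_of_mem_of_notMem_influenceZone hri (by rwa [Equiv.symm_apply_apply])
  rw [Equiv.symm_apply_apply] at heq
  have hik : i ≠ k := (ne_of_mem_of_not_mem (self_mem_influenceZone _ k ω) hi).symm
  exact ⟨.inl heq.symm, .inl (by rw [flipAt_of_ne hik, flipAt_of_ne hne, heq])⟩

lemma eqOn_iterate_flipAt (r : Equiv.Perm ι) (k : ι) (ω : ι → ℤˣ) (t : ℕ) :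
    Set.EqOn ((permLayer r)^[t] ω) ((permLayer r)^[t] (flipAt k ω)) (influenceZone r k ω)ᶜ := by
  refine eqOn_iterate_permLayer (fun i hi => ?_) (fun i hi => ?_) t
  · exact (flipAt_of_ne (ne_of_mem_of_not_mem (self_mem_influenceZone r k ω) hi).symm ω).symm
  · by_cases hnext : r i ∈ influenceZone r k ω
    · exact .inl (isFrozen_of_apply_mem_influenceZone hi hnext)
    by_cases hprev : r.symm i ∈ influenceZone r k ω
    · rw [← influenceZone_symm] at hprev
      have := isFrozen_of_apply_mem_influenceZone (by rwa [influenceZone_symm]) hprev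
      exact .inl ⟨this.1.symm, this.2.symm⟩
    · exact .inr ⟨hnext, hprev⟩

end Dynamics

section Influence

variable {ι : Type*} [Fintype ι]

/-- The sum of all signs in layer `T`. -/
def layerSum (r : Equiv.Perm ι) (T : ℕ) (ω : ι → ℤˣ) : ℝ :=
  ∑ i, (((permLayer r)^[T] ω i : ℤ) : ℝ)

lemma abs_units_sub_le (s t : ℤˣ) : |((s : ℤ) : ℝ) - ((t : ℤ) : ℝ)| ≤ 2 := by
  rcases Int.units_eq_one_or s with rfl | rfl <;> rcases Int.units_eq_one_or t with rfl | rfl <;>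
    norm_num

lemma card_sq_le_sum (s : Finset ℕ) : s.card ^ 2 ≤ ∑ d ∈ s, (2 * d + 1) := by
  induction s using Finset.induction_on_max with
  | empty => simp
  | insert j s hj ih =>
    have hjs : j ∉ s := fun h => (hj j h).false
    have hcard : s.card ≤ j := by
      simpa using Finset.card_le_card fun i hi => Finset.mem_range.2 (hj i hi)
    rw [Finset.card_insert_of_notMem hjs, Finset.sum_insert hjs]
    linarith

lemma sum_range_mul_half_pow (N : ℕ) :
    ∑ d ∈ Finset.range N, (2 * d + 1) * (1 / 2 : ℝ) ^ d = 6 - (4 * N + 6) * (1 / 2) ^ N := by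
  induction N with
  | zero => norm_num
  | succ N ih =>
    rw [Finset.sum_range_succ, ih]
    push_cast
    ring

variable [DecidableEq ι]

lemma abs_layerSum_sub_flipAt_le (r : Equiv.Perm ι) (T : ℕ) (k : ι) (ω : ι → ℤˣ) :
    |layerSum r T ω - layerSum r T (flipAt k ω)|
      ≤ 2 * ((runSteps r k ω).card + (runSteps r.symm k ω).card) := by
  calc |layerSum r T ω - layerSum r T (flipAt k ω)|
      = |∑ i ∈ influenceZone r k ω, ((((permLayer r)^[T] ω i : ℤ) : ℝ)
          - (((permLayer r)^[T] (flipAt k ω) i : ℤ) : ℝ))| := by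
        rw [layerSum, layerSum, ← Finset.sum_sub_distrib]
        congr 1
        refine (Finset.sum_subset (Finset.subset_univ _) fun i _ hi => ?_).symm
        rw [eqOn_iterate_flipAt r k ω T hi, sub_self]
    _ ≤ ∑ _i ∈ influenceZone r k ω, 2 :=
        (Finset.abs_sum_le_sum_abs _ _).trans
          (Finset.sum_le_sum fun _ _ => abs_units_sub_le _ _)
    _ ≤ 2 * ((runSteps r k ω).card + (runSteps r.symm k ω).card) := by
        rw [Finset.sum_const, nsmul_eq_mul, mul_comm]
        gcongr
        exact_mod_cast card_influenceZone_le r k ω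

lemma expect_ite_mem_runSteps_le (r : Equiv.Perm ι) (k : ι) (d : ℕ) :
    𝔼 ω, (if d ∈ runSteps r k ω then (1 : ℝ) else 0) ≤ 2 * (1 / 2) ^ d := by
  by_cases hd : d < minimalPeriod r k
  · have hfresh : 𝔼 ω, (if d ∈ runSteps r k ω then (1 : ℝ) else 0) = (1 / 2) ^ (d - 1) := by
      convert expect_ite_forall_eq_mul (Finset.Ioo 0 d) (a := fun e => r^[e] k)
        (b := fun e => r^[e + 1] k) (-1) ?_ ?_ using 4 with ω
      · rw [mem_runSteps, and_iff_right hd]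
        refine forall₂_congr fun e _ => ?_
        rw [ne_comm, Int.units_ne_iff_eq_neg, neg_one_mul]
      · simp
      · intro e he e' he' h
        simp only [Finset.coe_Ioo, Set.mem_Ioo] at he he'
        rw [iterate_eq_iterate_iff_of_lt_minimalPeriod (by lia) (by lia)] at h
        lia
      · intro e he e' he' hee h
        simp only [Finset.mem_Ioo] at he he'
        rw [iterate_eq_iterate_iff_of_lt_minimalPeriod (by lia) (by lia)] at h
        lia
    rw [hfresh]
    rcases d with _ | d
    · norm_num
    · rw [Nat.add_sub_cancel, pow_succ]
      linarith
  · simp only [mem_runSteps, hd, false_and, if_false, Finset.expect_const_zero]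
    positivity

lemma expect_card_runSteps_sq_le (r : Equiv.Perm ι) (k : ι) :
    𝔼 ω, ((runSteps r k ω).card : ℝ) ^ 2 ≤ 12 := by
  calc 𝔼 ω, ((runSteps r k ω).card : ℝ) ^ 2
      ≤ 𝔼 ω, ∑ d ∈ Finset.range (minimalPeriod r k),
          (2 * d + 1) * (if d ∈ runSteps r k ω then (1 : ℝ) else 0) := by
        refine Finset.expect_le_expect fun ω _ => ?_
        simp only [mul_ite, mul_one, mul_zero, ← Finset.sum_filter]
        have hfilter : {d ∈ Finset.range (minimalPeriod r k) | d ∈ runSteps r k ω}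
            = runSteps r k ω := by
          ext d
          simp [mem_runSteps]
        rw [hfilter]
        exact_mod_cast card_sq_le_sum _
    _ ≤ ∑ d ∈ Finset.range (minimalPeriod r k), (2 * d + 1) * (2 * (1 / 2 : ℝ) ^ d) := by
        simp only [Finset.expect_sum_comm, ← Finset.mul_expect]
        gcongr with d
        exact expect_ite_mem_runSteps_le r k d
    _ = 2 * (6 - (4 * minimalPeriod r k + 6) * (1 / 2) ^ minimalPeriod r k) := by
        rw [← sum_range_mul_half_pow, Finset.mul_sum]
        exact Finset.sum_congr rfl fun d _ => by ring
    _ ≤ 12 := by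
        have : (0 : ℝ) ≤ (4 * minimalPeriod r k + 6) * (1 / 2) ^ minimalPeriod r k := by
          positivity
        linarith

theorem expect_layerSum_sub_flipAt_sq_le (r : Equiv.Perm ι) (T : ℕ) (k : ι) :
    𝔼 ω, (layerSum r T ω - layerSum r T (flipAt k ω)) ^ 2 ≤ 192 := by
  calc 𝔼 ω, (layerSum r T ω - layerSum r T (flipAt k ω)) ^ 2
      ≤ 𝔼 ω, (8 * ((runSteps r k ω).card : ℝ) ^ 2
          + 8 * ((runSteps r.symm k ω).card : ℝ) ^ 2) := by
        refine Finset.expect_le_expect fun ω _ => ?_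
        have hsq := pow_le_pow_left₀ (abs_nonneg _) (abs_layerSum_sub_flipAt_le r T k ω) 2
        rw [sq_abs] at hsq
        linarith [sq_nonneg (((runSteps r k ω).card : ℝ) - (runSteps r.symm k ω).card)]
    _ ≤ 192 := by
        rw [Finset.expect_add_distrib, ← Finset.mul_expect, ← Finset.mul_expect]
        linarith [expect_card_runSteps_sq_le r k, expect_card_runSteps_sq_le r.symm k]

end Influence

section SmallBall

variable {α κ : Type*}

lemma expect_abs_sum_le_sqrt_card [Fintype α] [Nonempty α] [Fintype κ] {Y : κ → α → ℝ}
    (hY : ∀ j, 𝔼 ω, Y j ω ^ 2 ≤ 1) (horth : Pairwise fun j l => 𝔼 ω, Y j ω * Y l ω = 0) :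
    𝔼 ω, |∑ j, Y j ω| ≤ √(Fintype.card κ) := by
  have hdiag : ∀ j, ∑ l, 𝔼 ω, Y j ω * Y l ω = 𝔼 ω, Y j ω ^ 2 := fun j => by
    simp only [sq]
    exact Fintype.sum_eq_single j fun l hl => horth hl.symm
  refine Real.le_sqrt_of_sq_le ?_
  calc (𝔼 ω, |∑ j, Y j ω|) ^ 2
      ≤ 𝔼 ω, |∑ j, Y j ω| ^ 2 := by
        simpa using Finset.expect_mul_sq_le_sq_mul_sq Finset.univ (fun ω => |∑ j, Y j ω|) 1
    _ = ∑ j, 𝔼 ω, Y j ω ^ 2 := by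
        simp only [sq_abs, sq (∑ j, Y j _), Finset.sum_mul_sum, Finset.expect_sum_comm, hdiag]
    _ ≤ Fintype.card κ := by
        simpa using Finset.sum_le_sum fun j (_ : j ∈ Finset.univ) => hY j

/-- The truncation of `s` to the interval `[-b, b]`. -/
def clip (b s : ℝ) : ℝ :=
  max (-b) (min s b)

lemma abs_clip_le {b : ℝ} (hb : 0 ≤ b) (s : ℝ) : |clip b s| ≤ b :=
  abs_le.2 ⟨le_max_left _ _, max_le (neg_le_self hb) (min_le_right _ _)⟩

/-- The truncation level `K + a` is chosen so that no move from `[-K, K]` is truncated. -/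
lemma sq_mul_le_mul_clip_sub_clip {a K x : ℝ} (ha : 0 < a) (hK : 0 ≤ K)
    (hx : x = -1 ∨ x = 0 ∨ x = 1) (s : ℝ) :
    a * (x ^ 2 * if |s| ≤ K then 1 else 0)
      ≤ x * (clip (K + a) s - clip (K + a) (s - a * x)) := by
  simp only [clip]
  rcases hx with rfl | rfl | rfl <;> split_ifs with hs <;> (try rw [abs_le] at hs) <;> grind

/-- Reversible local moves `τ j` for a real observable `S`: the move `τ j` reverses the sign `X j`
(possibly `0`), leaves the other signs unchanged, and shifts `S` by `-a * X j`. -/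
structure LocalMoves (a : ℝ) (S : α → ℝ) (X : κ → α → ℝ) (τ : κ → α → α) : Prop where
  bijective : ∀ j, Bijective (τ j)
  sign : ∀ j ω, X j ω = -1 ∨ X j ω = 0 ∨ X j ω = 1
  sign_move_self : ∀ j ω, X j (τ j ω) = -X j ω
  sign_move_of_ne : ∀ j l, j ≠ l → ∀ ω, X l (τ j ω) = X l ω
  observable_move : ∀ j ω, S (τ j ω) = S ω - a * X j ω

namespace LocalMoves

variable {a K p : ℝ} {S : α → ℝ} {X : κ → α → ℝ} {τ : κ → α → α}

lemma sign_sq_le_one (h : LocalMoves a S X τ) (j : κ) (ω : α) : X j ω ^ 2 ≤ 1 := by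
  rcases h.sign j ω with hx | hx | hx <;> norm_num [hx]

variable [Fintype α]

lemma expect_sign_mul_sign (h : LocalMoves a S X τ) {j l : κ} (hjl : j ≠ l) :
    𝔼 ω, X j ω * X l ω = 0 := by
  have hneg : 𝔼 ω, X j ω * X l ω = 𝔼 ω, -(X j ω * X l ω) :=
    (Fintype.expect_bijective (τ j) (h.bijective j) _ _ fun ω => by
      rw [h.sign_move_self, h.sign_move_of_ne j l hjl, neg_mul, neg_neg])
  rw [Finset.expect_neg_distrib] at hneg
  linarith

lemma expect_sign_sq_mul_le (h : LocalMoves a S X τ) (ha : 0 < a) (hK : 0 ≤ K) (j : κ) :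
    a * 𝔼 ω, (X j ω ^ 2 * if |S ω| ≤ K then 1 else 0)
      ≤ 2 * 𝔼 ω, X j ω * clip (K + a) (S ω) := by
  have hmove : 𝔼 ω, X j ω * clip (K + a) (S ω)
      = 𝔼 ω, -(X j ω * clip (K + a) (S ω - a * X j ω)) :=
    (Fintype.expect_bijective (τ j) (h.bijective j) _ _ fun ω => by
      rw [h.sign_move_self, h.observable_move, neg_mul]).symm
  calc a * 𝔼 ω, (X j ω ^ 2 * if |S ω| ≤ K then 1 else 0)
      ≤ 𝔼 ω, (X j ω * clip (K + a) (S ω)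
          + -(X j ω * clip (K + a) (S ω - a * X j ω))) := by
        rw [Finset.mul_expect]
        refine Finset.expect_le_expect fun ω _ => ?_
        rw [← sub_eq_add_neg, ← mul_sub]
        exact sq_mul_le_mul_clip_sub_clip ha hK (h.sign j ω) (S ω)
    _ = 2 * 𝔼 ω, X j ω * clip (K + a) (S ω) := by
        rw [Finset.expect_add_distrib, ← hmove, two_mul]

variable [Fintype κ]

lemma expect_sum_sign_sq_mul_le [Nonempty α] (h : LocalMoves a S X τ) (ha : 0 < a) (hK : 0 ≤ K) :
    𝔼 ω, (∑ j, X j ω ^ 2) * (if |S ω| ≤ K then 1 else 0)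
      ≤ (2 * K / a + 2) * √(Fintype.card κ) := by
  have hstein : a * 𝔼 ω, (∑ j, X j ω ^ 2) * (if |S ω| ≤ K then 1 else 0)
      ≤ 2 * 𝔼 ω, (∑ j, X j ω) * clip (K + a) (S ω) := by
    simp only [Finset.sum_mul, Finset.expect_sum_comm, Finset.mul_sum]
    exact Finset.sum_le_sum fun j _ => h.expect_sign_sq_mul_le ha hK j
  have htrunc : 𝔼 ω, (∑ j, X j ω) * clip (K + a) (S ω)
      ≤ (K + a) * √(Fintype.card κ) := by
    calc 𝔼 ω, (∑ j, X j ω) * clip (K + a) (S ω)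
        ≤ 𝔼 ω, (K + a) * |∑ j, X j ω| := by
          refine Finset.expect_le_expect fun ω _ => (le_abs_self _).trans ?_
          rw [abs_mul, mul_comm]
          gcongr
          exact abs_clip_le (by positivity) _
      _ ≤ (K + a) * √(Fintype.card κ) := by
          rw [← Finset.mul_expect]
          gcongr
          refine expect_abs_sum_le_sqrt_card (fun j => ?_) fun j l hjl =>
            h.expect_sign_mul_sign hjl
          exact Finset.expect_le Finset.univ_nonempty fun ω _ => h.sign_sq_le_one j ω
  rw [show (2 * K / a + 2) * √(Fintype.card κ) = 2 * ((K + a) * √(Fintype.card κ)) / a by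
    field_simp, le_div_iff₀' ha]
  linarith

lemma expect_abs_sum_sub_le [Nonempty α] (h : LocalMoves a S X τ) (hp : ∀ j, 𝔼 ω, X j ω ^ 2 = p)
    (hpp : Pairwise fun j l => 𝔼 ω, X j ω ^ 2 * X l ω ^ 2 = p ^ 2) :
    𝔼 ω, |∑ j, (X j ω ^ 2 - p)| ≤ √(Fintype.card κ) := by
  have hcov : ∀ j l, 𝔼 ω, (X j ω ^ 2 - p) * (X l ω ^ 2 - p)
      = 𝔼 ω, X j ω ^ 2 * X l ω ^ 2 - p ^ 2 := fun j l => by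
    have hexpand : ∀ ω, (X j ω ^ 2 - p) * (X l ω ^ 2 - p)
        = X j ω ^ 2 * X l ω ^ 2 - p * X j ω ^ 2 - p * X l ω ^ 2 + p ^ 2 := fun ω => by ring
    simp only [hexpand, Finset.expect_add_distrib, Finset.expect_sub_distrib, ← Finset.mul_expect,
      hp, Fintype.expect_const]
    ring
  refine expect_abs_sum_le_sqrt_card (fun j => ?_) fun j l hjl =>
    (hcov j l).trans (by rw [hpp hjl, sub_self])
  have hfourth : 𝔼 ω, X j ω ^ 2 * X j ω ^ 2 ≤ 1 :=
    Finset.expect_le Finset.univ_nonempty fun ω _ =>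
      mul_le_one₀ (h.sign_sq_le_one j ω) (sq_nonneg _) (h.sign_sq_le_one j ω)
  simp only [sq (X j _ ^ 2 - p), hcov]
  linarith [sq_nonneg p]

theorem mul_sqrt_card_mul_expect_le [Nonempty α] (h : LocalMoves a S X τ) (ha : 0 < a)
    (hK : 0 ≤ K) (hp : ∀ j, 𝔼 ω, X j ω ^ 2 = p)
    (hpp : Pairwise fun j l => 𝔼 ω, X j ω ^ 2 * X l ω ^ 2 = p ^ 2) :
    p * √(Fintype.card κ) * 𝔼 ω, (if |S ω| ≤ K then (1 : ℝ) else 0) ≤ 2 * K / a + 3 := by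
  rcases isEmpty_or_nonempty κ with hκ | hκ
  · simp only [Fintype.card_eq_zero, Nat.cast_zero, Real.sqrt_zero, mul_zero, zero_mul]
    positivity
  have hcard : 0 < √(Fintype.card κ : ℝ) := by positivity
  have hsplit : p * Fintype.card κ * 𝔼 ω, (if |S ω| ≤ K then (1 : ℝ) else 0)
      ≤ 𝔼 ω, (∑ j, X j ω ^ 2) * (if |S ω| ≤ K then (1 : ℝ) else 0)
        + 𝔼 ω, |∑ j, (X j ω ^ 2 - p)| := by
    rw [Finset.mul_expect, ← Finset.expect_add_distrib]
    refine Finset.expect_le_expect fun ω _ => ?_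
    have hsum : ∑ j, (X j ω ^ 2 - p) = ∑ j, X j ω ^ 2 - p * Fintype.card κ := by
      simp [mul_comm]
    rw [hsum]
    split_ifs
    · linarith [neg_abs_le (∑ j, X j ω ^ 2 - p * Fintype.card κ)]
    · simp
  refine le_of_mul_le_mul_right ?_ hcard
  have := h.expect_sum_sign_sq_mul_le ha hK
  have := h.expect_abs_sum_sub_le hp hpp
  calc (p * √(Fintype.card κ) * 𝔼 ω, (if |S ω| ≤ K then (1 : ℝ) else 0)) * √(Fintype.card κ)
      = p * Fintype.card κ * 𝔼 ω, (if |S ω| ≤ K then (1 : ℝ) else 0) := by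
        rw [mul_right_comm, mul_assoc p, Real.mul_self_sqrt (Nat.cast_nonneg _)]
    _ ≤ (2 * K / a + 3) * √(Fintype.card κ) := by linarith

end LocalMoves

end SmallBall

section Blocks

variable {ι : Type*}

/-- The `j`-th block of six consecutive sites `r^[6 * j] k, …, r^[6 * j + 5] k` consists of three
pairs of equal signs. All its sites are then frozen, and they remain so when the middle pair is
flipped. -/
def GoodBlock (r : Equiv.Perm ι) (k : ι) (j : ℕ) (ω : ι → ℤˣ) : Prop :=
  ∀ p ∈ Finset.Ico (3 * j) (3 * j + 3), ω (r^[2 * p + 1] k) = ω (r^[2 * p] k)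

open Classical in
/-- The configuration obtained from `ω` by flipping the middle pair of the `j`-th block. -/
noncomputable def middleFlip (r : Equiv.Perm ι) (k : ι) (j : ℕ) (ω : ι → ℤˣ) : ι → ℤˣ :=
  fun i => if i = r^[6 * j + 2] k ∨ i = r^[6 * j + 3] k then -ω i else ω i

open Classical in
/-- The move which flips the middle pair of the `j`-th block if this block is good. -/
noncomputable def blockMove (r : Equiv.Perm ι) (k : ι) (j : ℕ) (ω : ι → ℤˣ) : ι → ℤˣ :=
  if GoodBlock r k j ω then middleFlip r k j ω else ω

open Classical in
/-- The common sign of the middle pair of the `j`-th block, or `0` if this block is not good. -/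
noncomputable def blockSign (r : Equiv.Perm ι) (k : ι) (j : ℕ) (ω : ι → ℤˣ) : ℝ :=
  if GoodBlock r k j ω then ((ω (r^[6 * j + 2] k) : ℤ) : ℝ) else 0

variable {r : Equiv.Perm ι} {k : ι} {j l : ℕ} {ω : ι → ℤˣ}

lemma middleFlip_involutive : Involutive (middleFlip r k j) := fun ω => by
  funext i
  simp only [middleFlip]
  split_ifs
  · exact neg_neg _
  · rfl

lemma middleFlip_iterate {e : ℕ} (hj : 6 * j + 6 ≤ minimalPeriod r k) (he : e < minimalPeriod r k) :
    middleFlip r k j ω (r^[e] k)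
      = if e = 6 * j + 2 ∨ e = 6 * j + 3 then -ω (r^[e] k) else ω (r^[e] k) := by
  have hsite : ∀ d < minimalPeriod r k, r^[e] k = r^[d] k ↔ e = d := fun d hd =>
    iterate_eq_iterate_iff_of_lt_minimalPeriod he hd
  simp only [middleFlip, hsite (6 * j + 2) (by lia), hsite (6 * j + 3) (by lia)]

lemma goodBlock_middleFlip (hj : 6 * j + 6 ≤ minimalPeriod r k)
    (hl : 6 * l + 6 ≤ minimalPeriod r k) :
    GoodBlock r k l (middleFlip r k j ω) ↔ GoodBlock r k l ω := by
  refine forall₂_congr fun p hp => ?_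
  rw [Finset.mem_Ico] at hp
  rw [middleFlip_iterate hj (by lia), middleFlip_iterate hj (by lia)]
  have hodd : (2 * p + 1 = 6 * j + 2 ∨ 2 * p + 1 = 6 * j + 3) ↔ p = 3 * j + 1 := by lia
  have heven : (2 * p = 6 * j + 2 ∨ 2 * p = 6 * j + 3) ↔ p = 3 * j + 1 := by lia
  simp only [hodd, heven]
  split_ifs
  · exact neg_inj
  · rfl

lemma GoodBlock.isFrozen (h : GoodBlock r k j ω) {e : ℕ} (he : e ∈ Finset.Ico (6 * j) (6 * j + 6)) :
    IsFrozen r ω (r^[e] k) := by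
  rw [Finset.mem_Ico] at he
  rcases Nat.even_or_odd' e with ⟨p, rfl | rfl⟩
  · left
    rw [← iterate_succ_apply' r]
    exact (h p (Finset.mem_Ico.2 (by lia))).symm
  · right
    rw [iterate_succ_apply', Equiv.symm_apply_apply, ← iterate_succ_apply' r]
    exact h p (Finset.mem_Ico.2 (by lia))

lemma GoodBlock.middle_eq (h : GoodBlock r k j ω) :
    ω (r^[6 * j + 3] k) = ω (r^[6 * j + 2] k) := by
  have := h (3 * j + 1) (Finset.mem_Ico.2 (by lia))
  rwa [show 2 * (3 * j + 1) + 1 = 6 * j + 3 by ring, show 2 * (3 * j + 1) = 6 * j + 2 by ring]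
    at this

lemma GoodBlock.eqOn_iterate_middleFlip (h : GoodBlock r k j ω)
    (hj : 6 * j + 6 ≤ minimalPeriod r k) (t : ℕ) :
    Set.EqOn ((permLayer r)^[t] ω) ((permLayer r)^[t] (middleFlip r k j ω))
      {r^[6 * j + 2] k, r^[6 * j + 3] k}ᶜ := by
  have hfrozen : ∀ e ∈ Finset.Ico (6 * j) (6 * j + 6),
      IsFrozen r ω (r^[e] k) ∧ IsFrozen r (middleFlip r k j ω) (r^[e] k) := fun e he =>
    ⟨h.isFrozen he, ((goodBlock_middleFlip hj hj).2 h).isFrozen he⟩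
  have hagree : Set.EqOn ω (middleFlip r k j ω) {r^[6 * j + 2] k, r^[6 * j + 3] k}ᶜ :=
    fun i hi => (if_neg hi).symm
  refine eqOn_iterate_permLayer hagree (fun i hi => ?_) t
  have hnext : r i = r^[6 * j + 2] k → i = r^[6 * j + 1] k := fun he => by
    rwa [iterate_succ_apply', r.injective.eq_iff] at he
  have hmiddle : r i = r^[6 * j + 3] k → i = r^[6 * j + 2] k := fun he => by
    rwa [iterate_succ_apply', r.injective.eq_iff] at he
  have hprev : ∀ e, r.symm i = r^[e] k → i = r^[e + 1] k := fun e he => by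
    rw [iterate_succ_apply', ← he, Equiv.apply_symm_apply]
  by_cases h₁ : i = r^[6 * j + 1] k
  · exact .inl (h₁ ▸ hfrozen _ (Finset.mem_Ico.2 (by lia)))
  by_cases h₄ : i = r^[6 * j + 4] k
  · exact .inl (h₄ ▸ hfrozen _ (Finset.mem_Ico.2 (by lia)))
  simp only [Set.mem_compl_iff, Set.mem_insert_iff, Set.mem_singleton_iff, not_or] at hi ⊢
  exact .inr ⟨⟨mt hnext h₁, mt hmiddle hi.1⟩, mt (hprev _) hi.2, mt (hprev _) h₄⟩

lemma blockMove_involutive (hj : 6 * j + 6 ≤ minimalPeriod r k) :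
    Involutive (blockMove r k j) := fun ω => by
  by_cases h : GoodBlock r k j ω <;>
    simp [blockMove, h, goodBlock_middleFlip hj hj, middleFlip_involutive.eq_iff]

lemma blockSign_eq_or (r : Equiv.Perm ι) (k : ι) (j : ℕ) (ω : ι → ℤˣ) :
    blockSign r k j ω = -1 ∨ blockSign r k j ω = 0 ∨ blockSign r k j ω = 1 := by
  rw [blockSign]
  split_ifs
  · rcases Int.units_eq_one_or (ω (r^[6 * j + 2] k)) with h | h <;> rw [h] <;> simp
  · simp

open Classical in
lemma blockSign_sq : blockSign r k j ω ^ 2 = if GoodBlock r k j ω then 1 else 0 := by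
  rw [blockSign]
  split_ifs
  · rcases Int.units_eq_one_or (ω (r^[6 * j + 2] k)) with h | h <;> rw [h] <;> simp
  · simp

lemma blockSign_blockMove_self (hj : 6 * j + 6 ≤ minimalPeriod r k) :
    blockSign r k j (blockMove r k j ω) = -blockSign r k j ω := by
  by_cases h : GoodBlock r k j ω
  · rw [blockMove, if_pos h, blockSign, blockSign, goodBlock_middleFlip hj hj,
      middleFlip_iterate hj (by lia), if_pos h, if_pos h, if_pos (.inl rfl)]
    push_cast
    rfl
  · rw [blockMove, if_neg h, blockSign, if_neg h, neg_zero]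

lemma blockSign_blockMove_of_ne (hj : 6 * j + 6 ≤ minimalPeriod r k)
    (hl : 6 * l + 6 ≤ minimalPeriod r k) (hjl : j ≠ l) :
    blockSign r k l (blockMove r k j ω) = blockSign r k l ω := by
  by_cases h : GoodBlock r k j ω
  · have hsite : ¬(6 * l + 2 = 6 * j + 2 ∨ 6 * l + 2 = 6 * j + 3) := by lia
    rw [blockMove, if_pos h, blockSign, blockSign, goodBlock_middleFlip hj hl,
      middleFlip_iterate hj (by lia), if_neg hsite]
  · rw [blockMove, if_neg h]

lemma layerSum_blockMove [Fintype ι] (hj : 6 * j + 6 ≤ minimalPeriod r k) (T : ℕ) :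
    layerSum r T (blockMove r k j ω) = layerSum r T ω - 4 * blockSign r k j ω := by
  classical
  by_cases h : GoodBlock r k j ω
  swap
  · rw [blockMove, blockSign, if_neg h, if_neg h, mul_zero, sub_zero]
  rw [blockMove, blockSign, if_pos h, if_pos h, eq_sub_iff_add_eq', ← eq_sub_iff_add_eq]
  have hne : r^[6 * j + 2] k ≠ r^[6 * j + 3] k := by
    rw [Ne, iterate_eq_iterate_iff_of_lt_minimalPeriod (by lia) (by lia)]
    lia
  have hiterate : ∀ e ∈ Finset.Ico (6 * j + 2) (6 * j + 4),
      (permLayer r)^[T] ω (r^[e] k) = ω (r^[e] k) ∧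
        (permLayer r)^[T] (middleFlip r k j ω) (r^[e] k) = -ω (r^[e] k) := fun e he => by
    rw [Finset.mem_Ico] at he
    have hblock : e ∈ Finset.Ico (6 * j) (6 * j + 6) := Finset.mem_Ico.2 (by lia)
    refine ⟨(h.isFrozen hblock).iterate_eq T, ?_⟩
    rw [(((goodBlock_middleFlip hj hj).2 h).isFrozen hblock).iterate_eq T,
      middleFlip_iterate hj (by lia), if_pos (by lia)]
  rw [layerSum, layerSum, ← Finset.sum_sub_distrib,
    ← Finset.sum_subset (Finset.subset_univ {r^[6 * j + 2] k, r^[6 * j + 3] k}) fun i _ hi => ?_,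
    Finset.sum_pair hne]
  · rw [(hiterate (6 * j + 2) (by simp)).1, (hiterate (6 * j + 2) (by simp)).2,
      (hiterate (6 * j + 3) (by simp)).1, (hiterate (6 * j + 3) (by simp)).2, h.middle_eq]
    push_cast
    ring
  · rw [h.eqOn_iterate_middleFlip hj T (by simpa using hi), sub_self]

lemma localMoves_blockMove [Fintype ι] (r : Equiv.Perm ι) (k : ι) (T : ℕ) :
    LocalMoves 4 (layerSum r T) (fun j : Fin (minimalPeriod r k / 6) => blockSign r k j)
      (fun j => blockMove r k j) where
  bijective j := (blockMove_involutive (by lia)).bijective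
  sign j ω := blockSign_eq_or r k j ω
  sign_move_self j _ := blockSign_blockMove_self (by lia)
  sign_move_of_ne j l hjl _ :=
    blockSign_blockMove_of_ne (by lia) (by lia) (Fin.val_injective.ne hjl)
  observable_move j _ := layerSum_blockMove (by lia) T

variable [Fintype ι] [DecidableEq ι]

lemma expect_ite_forall_pair_eq {s : Finset ℕ} (hs : ∀ p ∈ s, 2 * p + 2 ≤ minimalPeriod r k) :
    𝔼 ω : ι → ℤˣ, (if ∀ p ∈ s, ω (r^[2 * p + 1] k) = ω (r^[2 * p] k) then (1 : ℝ) else 0)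
      = (1 / 2) ^ s.card := by
  simpa only [one_mul] using expect_ite_forall_eq_mul s (a := fun p => r^[2 * p] k)
    (b := fun p => r^[2 * p + 1] k) 1
    (fun p hp q hq h => by
      have := hs p hp
      have := hs q hq
      rw [iterate_eq_iterate_iff_of_lt_minimalPeriod (by lia) (by lia)] at h
      lia)
    (fun p hp q hq _ h => by
      have := hs p hp
      have := hs q hq
      rw [iterate_eq_iterate_iff_of_lt_minimalPeriod (by lia) (by lia)] at h
      lia)

lemma expect_blockSign_sq (hj : 6 * j + 6 ≤ minimalPeriod r k) :
    𝔼 ω, blockSign r k j ω ^ 2 = 1 / 8 := by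
  have hs : ∀ p ∈ Finset.Ico (3 * j) (3 * j + 3), 2 * p + 2 ≤ minimalPeriod r k := fun p hp => by
    rw [Finset.mem_Ico] at hp
    lia
  calc 𝔼 ω, blockSign r k j ω ^ 2
      = (1 / 2 : ℝ) ^ (Finset.Ico (3 * j) (3 * j + 3)).card := by
        rw [← expect_ite_forall_pair_eq hs]
        exact Finset.expect_congr rfl fun ω _ => blockSign_sq.trans (by congr)
    _ = 1 / 8 := by
        rw [Nat.card_Ico, Nat.add_sub_cancel_left]
        norm_num

lemma expect_blockSign_sq_mul_blockSign_sq (hj : 6 * j + 6 ≤ minimalPeriod r k)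
    (hl : 6 * l + 6 ≤ minimalPeriod r k) (hjl : j ≠ l) :
    𝔼 ω, blockSign r k j ω ^ 2 * blockSign r k l ω ^ 2 = (1 / 8) ^ 2 := by
  set s := Finset.Ico (3 * j) (3 * j + 3)
  set t := Finset.Ico (3 * l) (3 * l + 3)
  have hst : Disjoint s t := Finset.disjoint_left.2 fun p hp hp' => by
    rw [Finset.mem_Ico] at hp hp'
    lia
  have hunion : ∀ p ∈ s ∪ t, 2 * p + 2 ≤ minimalPeriod r k := fun p hp => by
    simp only [s, t, Finset.mem_union, Finset.mem_Ico] at hp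
    lia
  calc 𝔼 ω, blockSign r k j ω ^ 2 * blockSign r k l ω ^ 2
      = (1 / 2 : ℝ) ^ (s ∪ t).card := by
        rw [← expect_ite_forall_pair_eq hunion]
        refine Finset.expect_congr rfl fun ω _ => ?_
        rw [blockSign_sq, blockSign_sq, ite_zero_mul_ite_zero, mul_one]
        simp only [Finset.forall_mem_union]
        congr
    _ = (1 / 8) ^ 2 := by
        rw [Finset.card_union_of_disjoint hst, Nat.card_Ico, Nat.card_Ico, Nat.add_sub_cancel_left,
          Nat.add_sub_cancel_left]
        norm_num

theorem sqrt_minimalPeriod_mul_expect_abs_layerSum_le (r : Equiv.Perm ι) (k : ι) (T : ℕ) {K : ℝ}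
    (hK : 0 ≤ K) :
    √(minimalPeriod r k) * 𝔼 ω, (if |layerSum r T ω| ≤ K then (1 : ℝ) else 0)
      ≤ 12 * (K + 7) := by
  set q := 𝔼 ω, (if |layerSum r T ω| ≤ K then (1 : ℝ) else 0)
  have : 0 ≤ q := Finset.expect_nonneg fun ω _ => by split_ifs <;> norm_num
  have hq₁ : q ≤ 1 := Finset.expect_le Finset.univ_nonempty fun ω _ => by split_ifs <;> norm_num
  have hblocks := (localMoves_blockMove r k T).mul_sqrt_card_mul_expect_le four_pos hK
    (fun j => expect_blockSign_sq (by lia)) fun j l hjl =>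
      expect_blockSign_sq_mul_blockSign_sq (by lia) (by lia) (Fin.val_injective.ne hjl)
  rw [Fintype.card_fin] at hblocks
  have hsqrt : √(minimalPeriod r k : ℝ) ≤ 3 * √((minimalPeriod r k / 6 : ℕ) : ℝ) + 3 := by
    rw [Real.sqrt_le_left (by positivity)]
    have hdiv : (minimalPeriod r k : ℝ) ≤ 6 * (minimalPeriod r k / 6 : ℕ) + 5 := by
      exact_mod_cast (by lia : minimalPeriod r k ≤ 6 * (minimalPeriod r k / 6) + 5)
    nlinarith [Real.sq_sqrt (Nat.cast_nonneg (α := ℝ) (minimalPeriod r k / 6)),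
      Real.sqrt_nonneg ((minimalPeriod r k / 6 : ℕ) : ℝ)]
  calc √(minimalPeriod r k : ℝ) * q
      ≤ (3 * √((minimalPeriod r k / 6 : ℕ) : ℝ) + 3) * q := by gcongr
    _ ≤ 12 * (K + 7) := by linarith

end Blocks

section Disagreement

instance isFiniteMeasure_signLaw (p : ℝ) : IsFiniteMeasure (signLaw p) :=
  ⟨by simp [signLaw]⟩

lemma signLaw_singleton (p : ℝ) (s : ℤˣ) :
    signLaw p {s} = ENNReal.ofReal (if s = 1 then 1 - p else p) := by
  rcases Int.units_eq_one_or s with rfl | rfl <;> simp [signLaw]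

variable {n : ℕ} {ε : ℝ}

lemma pi_signLaw_singleton (hε₀ : 0 ≤ ε) (hε₁ : ε ≤ 1) (η : Fin n → ℤˣ) :
    (Measure.pi fun _ => signLaw ε) {η} = ENNReal.ofReal (noiseWeight ε η) := by
  rw [Measure.pi_singleton, noiseWeight, ENNReal.ofReal_prod_of_nonneg]
  · simp only [signLaw_singleton]
  · intro i _
    split_ifs <;> linarith

lemma noiseLaw_singleton (hε₀ : 0 ≤ ε) (hε₁ : ε ≤ 1) (ω η : Fin n → ℤˣ) :
    noiseLaw n ε {(ω, η)}
      = ENNReal.ofReal (noiseWeight ε η / Fintype.card (Fin n → ℤˣ)) := by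
  rw [noiseLaw, ← Set.singleton_prod_singleton, Measure.prod_prod,
    pi_signLaw_singleton (by norm_num) (by norm_num), pi_signLaw_singleton hε₀ hε₁,
    noiseWeight_half, ← ENNReal.ofReal_mul (by positivity), inv_mul_eq_div]

lemma disagreementProb_eq (hε₀ : 0 ≤ ε) (hε₁ : ε ≤ 1) (f : (Fin n → ℤˣ) → ℤˣ) :
    disagreementProb f ε
      = ENNReal.ofReal (𝔼 ω, ∑ η, noiseWeight ε η * if f ω = f (ω * η) then 0 else 1) := by
  have hfinset : {p : (Fin n → ℤˣ) × (Fin n → ℤˣ) | f p.1 ≠ f (p.1 * p.2)}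
      = ({p | f p.1 ≠ f (p.1 * p.2)} : Finset ((Fin n → ℤˣ) × (Fin n → ℤˣ))) := by
    ext
    simp
  rw [disagreementProb, hfinset, ← sum_measure_singleton]
  simp only [noiseLaw_singleton hε₀ hε₁]
  rw [← ENNReal.ofReal_sum_of_nonneg fun p _ =>
      div_nonneg (noiseWeight_nonneg hε₀ hε₁ p.2) (Nat.cast_nonneg _),
    Finset.sum_filter, Fintype.sum_prod_type, Fintype.expect_eq_sum_div_card, Finset.sum_div]
  simp only [Finset.sum_div, ite_not, mul_ite, mul_zero, mul_one, ite_div, zero_div]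

/-- On sign valued functions, disagreement is a quarter of the squared difference. -/
lemma disagreementProb_eq_noiseEnergy (hε₀ : 0 ≤ ε) (hε₁ : ε ≤ 1) (f : (Fin n → ℤˣ) → ℤˣ) :
    disagreementProb f ε = ENNReal.ofReal (noiseEnergy ε (fun ω => ((f ω : ℤ) : ℝ) / 2)) := by
  rw [disagreementProb_eq hε₀ hε₁, noiseEnergy]
  congr! 6 with ω _ η
  rcases Int.units_eq_one_or (f ω) with h | h <;>
    rcases Int.units_eq_one_or (f (ω * η)) with h' | h' <;> rw [h, h'] <;> norm_num

lemma disagreementProb_le_mul (hε₀ : 0 ≤ ε) (hε₁ : ε ≤ 1) (f : (Fin n → ℤˣ) → ℤˣ) :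
    disagreementProb f ε ≤ ENNReal.ofReal (n * ε) := by
  rw [disagreementProb_eq_noiseEnergy hε₀ hε₁]
  refine ENNReal.ofReal_le_ofReal ((noiseEnergy_le_mul_flipEnergy hε₀ hε₁ _).trans ?_)
  rw [mul_comm]
  gcongr
  calc flipEnergy (fun ω => ((f ω : ℤ) : ℝ) / 2) ≤ ∑ _k : Fin n, 1 := by
        refine Finset.sum_le_sum fun k _ => Finset.expect_le Finset.univ_nonempty fun ω _ => ?_
        have := abs_le.1 (abs_units_sub_le (f ω) (f (flipAt k ω)))
        rw [sq_le_one_iff_abs_le_one, abs_le]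
        exact ⟨by linarith, by linarith⟩
    _ = n := by simp

lemma ite_sign_eq_le {s t K : ℝ} (hK : 0 < K) :
    (if (if 0 < s then (1 : ℤˣ) else -1) = (if 0 < t then 1 else -1) then (0 : ℝ) else 1)
      ≤ (if |s| ≤ K then 1 else 0) + (s - t) ^ 2 / K ^ 2 := by
  have hnonneg : 0 ≤ (s - t) ^ 2 / K ^ 2 := by positivity
  by_cases hs : |s| ≤ K
  · rw [if_pos hs]
    split_ifs <;> linarith
  rw [if_neg hs, zero_add]
  by_cases hst : |s - t| < K
  · have hsame : (0 < s ↔ 0 < t) := by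
      have := abs_lt.1 hst
      rcases lt_abs.1 (not_le.1 hs) with h | h
      · exact iff_of_true (by linarith) (by linarith)
      · exact iff_of_false (by linarith) (by linarith)
    simpa only [hsame, if_true] using hnonneg
  · have hfar : 1 ≤ (s - t) ^ 2 / K ^ 2 := by
      rw [one_le_div (by positivity), ← sq_abs (s - t)]
      exact pow_le_pow_left₀ hK.le (not_lt.1 hst) 2
    split_ifs <;> linarith

lemma disagreementProb_sign_le (hε₀ : 0 ≤ ε) (hε₁ : ε ≤ 1) (S : (Fin n → ℤˣ) → ℝ) {K : ℝ}
    (hK : 0 < K) :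
    disagreementProb (fun ω => if 0 < S ω then 1 else -1) ε
      ≤ ENNReal.ofReal (𝔼 ω, (if |S ω| ≤ K then (1 : ℝ) else 0) + noiseEnergy ε S / K ^ 2) := by
  rw [disagreementProb_eq hε₀ hε₁,
    ← expect_sum_noiseWeight_mul ε fun ω => if |S ω| ≤ K then (1 : ℝ) else 0, noiseEnergy,
    Finset.expect_div, ← Finset.expect_add_distrib]
  refine ENNReal.ofReal_le_ofReal (Finset.expect_le_expect fun ω _ => ?_)
  rw [Finset.sum_div, ← Finset.sum_add_distrib]
  refine Finset.sum_le_sum fun η _ => ?_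
  rw [mul_div_assoc, ← mul_add]
  exact mul_le_mul_of_nonneg_left (ite_sign_eq_le hK) (noiseWeight_nonneg hε₀ hε₁ η)

end Disagreement

section Cycle

variable {n : ℕ}

lemma val_iterate_finRotate (a : ℕ) (k : Fin n) : ((finRotate n)^[a] k : ℕ) = (k + a) % n := by
  obtain _ | n := n
  · exact k.elim0
  induction a with
  | zero => exact (Nat.mod_eq_of_lt k.isLt).symm
  | succ a ih =>
    rw [iterate_succ_apply', finRotate_apply, Fin.val_add, ih, Fin.val_one', ← Nat.add_mod,
      add_assoc]

lemma minimalPeriod_finRotate (k : Fin n) : minimalPeriod (finRotate n) k = n := by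
  refine Nat.dvd_right_iff_eq.1 fun a => ?_
  rw [← isPeriodicPt_iff_minimalPeriod_dvd, IsPeriodicPt, IsFixedPt, Fin.ext_iff,
    val_iterate_finRotate]
  conv_lhs => rhs; rw [← Nat.mod_eq_of_lt k.isLt]
  exact Nat.add_modEq_left_iff

lemma cycleIteratedMajority_eq_sign (n T : ℕ) :
    cycleIteratedMajority n T = fun ω => if 0 < layerSum (finRotate n) T ω then 1 else -1 := by
  funext ω
  have hcast : layerSum (finRotate n) T ω = ((∑ i, ((cycleLayer n)^[T] ω i : ℤ) : ℤ) : ℝ) := by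
    push_cast
    rfl
  rw [hcast, cycleIteratedMajority, majority]
  simp only [Int.cast_pos]

lemma noiseEnergy_layerSum_le {ε : ℝ} (hε₀ : 0 ≤ ε) (hε₁ : ε ≤ 1) (r : Equiv.Perm (Fin n))
    (T : ℕ) : noiseEnergy ε (layerSum r T) ≤ ε * (192 * n) := by
  refine (noiseEnergy_le_mul_flipEnergy hε₀ hε₁ _).trans (mul_le_mul_of_nonneg_left ?_ hε₀)
  calc flipEnergy (layerSum r T) ≤ ∑ _k : Fin n, 192 :=
        Finset.sum_le_sum fun k _ => expect_layerSum_sub_flipAt_sq_le r T k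
    _ = 192 * n := by simp [mul_comm]

/-- The window `K = δ√n` balances the small ball probability `O(K / √n)` against the noise term
`O(δ³n / K²)`. -/
lemma disagreementProb_cycleIteratedMajority_le (n T : ℕ) {δ : ℝ} (hδ₀ : 0 < δ) (hδ₁ : δ ≤ 1) :
    disagreementProb (cycleIteratedMajority n T) (δ ^ 3) ≤ ENNReal.ofReal (288 * δ) := by
  have hε₀ : 0 ≤ δ ^ 3 := by positivity
  have hε₁ : δ ^ 3 ≤ 1 := pow_le_one₀ hδ₀.le hδ₁
  rcases le_total (n * δ ^ 2) 1 with hn | hn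
  · refine (disagreementProb_le_mul hε₀ hε₁ _).trans (ENNReal.ofReal_le_ofReal ?_)
    nlinarith
  have hn₀ : 0 < n := Nat.pos_of_ne_zero fun h => by norm_num [h] at hn
  have hsqrt : 0 < √(n : ℝ) := by positivity
  have hK : 0 < δ * √n := by positivity
  have hsmall : 𝔼 ω, (if |layerSum (finRotate n) T ω| ≤ δ * √n then (1 : ℝ) else 0) ≤ 96 * δ := by
    have hball := sqrt_minimalPeriod_mul_expect_abs_layerSum_le (finRotate n) ⟨0, hn₀⟩ T hK.le
    rw [minimalPeriod_finRotate] at hball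
    have hone : 1 ≤ δ * √n := by
      rw [← one_le_sq_iff₀ hK.le, mul_pow, Real.sq_sqrt (Nat.cast_nonneg n), mul_comm]
      exact hn
    refine le_of_mul_le_mul_left ?_ hsqrt
    linarith
  have hnoise : noiseEnergy (δ ^ 3) (layerSum (finRotate n) T) / (δ * √n) ^ 2 ≤ 192 * δ := by
    rw [div_le_iff₀ (by positivity), mul_pow, Real.sq_sqrt (Nat.cast_nonneg n)]
    linarith [noiseEnergy_layerSum_le hε₀ hε₁ (finRotate n) T]
  rw [cycleIteratedMajority_eq_sign]
  refine (disagreementProb_sign_le hε₀ hε₁ _ hK).trans (ENNReal.ofReal_le_ofReal ?_)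
  linarith

end Cycle

theorem mainTheorem8_general {ι : Type*} (n T : ι → ℕ) :
    NoiseStable fun i => cycleIteratedMajority (n i) (T i) := by
  have hlimit : Tendsto (fun ε : ℝ => ENNReal.ofReal (288 * ε ^ (3⁻¹ : ℝ))) (𝓝[>] 0) (𝓝 0) := by
    have hcont : Continuous fun ε : ℝ => ENNReal.ofReal (288 * ε ^ (3⁻¹ : ℝ)) :=
      ENNReal.continuous_ofReal.comp
        (continuous_const.mul (Real.continuous_rpow_const (by norm_num)))
    simpa using (hcont.tendsto 0).mono_left nhdsWithin_le_nhds
  refine tendsto_of_tendsto_of_tendsto_of_le_of_le' tendsto_const_nhds hlimit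
    (.of_forall fun _ => zero_le) ?_
  filter_upwards [Ioc_mem_nhdsGT one_pos] with ε hε
  refine iSup_le fun i => ?_
  have hcube : (ε ^ (3⁻¹ : ℝ)) ^ 3 = ε := by
    exact_mod_cast Real.rpow_inv_natCast_pow hε.1.le (n := 3) (by norm_num)
  calc disagreementProb (cycleIteratedMajority (n i) (T i)) ε
      = disagreementProb (cycleIteratedMajority (n i) (T i)) ((ε ^ (3⁻¹ : ℝ)) ^ 3) := by rw [hcube]
    _ ≤ ENNReal.ofReal (288 * ε ^ (3⁻¹ : ℝ)) :=
        disagreementProb_cycleIteratedMajority_le _ _ (Real.rpow_pos_of_pos hε.1 _)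
          (Real.rpow_le_one hε.1.le hε.2 (by norm_num))

theorem mainTheorem8 (T : ℕ → ℕ) :
    NoiseStable (fun n : {n : ℕ // Odd n} => cycleIteratedMajority (n : ℕ) (T n)) :=
  mainTheorem8_general _ _
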